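/- Let $E$ be a real Banach lattice and let $E'$ be its topological dual, ordered by $f\le g$ iff $f(x)\le g(x)$ for all $x\ge 0$ in $E$; with this order $E'$ is a vector lattice, and $|f|=f\vee(-f)$. We use the following terminology. - The norm of $E$ is order continuous if $\|x_\alpha\|\to 0$ for every decreasing net $(x_\alpha)$ in $E$ with $\inf_\alpha x_\alpha=0$. - The lattice operations of $E$ are weakly sequentially continuous if $x_n\to x$ and $y_n\to y$ weakly in $E$ imply $x_n\vee y_n\to x\vee y$ and $x_n\wedge y_n\to x\wedge y$ weakly. - A bounded set $B\subset E$ is almost limited if every weak* null sequence $(f_n)$ in $E'$ that is disjoint (i.e. $|f_n|\wedge|f_m|=0$ for $n\ne m$) satisfies $\sup_{x\in B}|f_n(x)|\to 0$. A sequence $(x_n)$ in $E$ is almost limited if the set $\{x_n:n\in\mathbb N\}$ is almost limited. - A set $A\subset E'$ is strong L-limited if $\sup_{f\in A}|f(x_n)|\to 0$ for every almost limited, weakly null sequence $(x_n)$ in $E$. - The solid hull of $A\subset E'$ is the smallest solid set containing $A$, that is, $\{g\in E' : |g|\le |f| \text{ for some } f\in A\}$. **Theorem.** Suppose that $E$ has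 order continuous norm and that the lattice operations of $E$ are weakly sequentially continuous. If $A\subset E'$ is strong L-limited, then the solid hull of $A$ is also strong L-limited. -/

import Mathlib

open Filter Topology

universe u

namespace BanachLattice

section Dual

/-! The dual `E'` of a normed lattice `E`, with its usual order `f ≤ g ↔ ∀ x ≥ 0, f x ≤ g x`,
is a vector lattice (Riesz and Kantorovich). -/

variable {E : Type u} [NormedAddCommGroup E] [NormedSpace ℝ E] [Lattice E]
  [IsOrderedAddMonoid E] [HasSolidNorm E]

/-- The usual order of the dual: `f ≤ g` if and only if `f x ≤ g x` for all `x ≥ 0`. -/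
instance dualPartialOrder : PartialOrder (StrongDual ℝ E) where
  le f g := ∀ x : E, 0 ≤ x → f x ≤ g x
  le_refl f x _ := le_rfl
  le_trans f g h hfg hgh x hx := (hfg x hx).trans (hgh x hx)
  le_antisymm f g hfg hgf := by
    ext x
    have h1 := le_antisymm (hfg _ (posPart_nonneg x)) (hgf _ (posPart_nonneg x))
    have h2 := le_antisymm (hfg _ (negPart_nonneg x)) (hgf _ (negPart_nonneg x))
    rw [← posPart_sub_negPart x, map_sub, map_sub, h1, h2]

theorem dual_le_def {f g : StrongDual ℝ E} : f ≤ g ↔ ∀ x : E, 0 ≤ x → f x ≤ g x := Iff.rfl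

/-- On the positive cone, the positive part of `f` is `x ↦ sup {f y | 0 ≤ y ≤ x}`. -/
noncomputable def posAux (f : StrongDual ℝ E) (x : E) : ℝ := sSup (f '' Set.Icc 0 x)

theorem apply_le_of_mem_Icc (f : StrongDual ℝ E) {x y : E} (hy : y ∈ Set.Icc 0 x) :
    f y ≤ ‖f‖ * ‖x‖ := by
  have hx : 0 ≤ x := hy.1.trans hy.2
  have h : ‖y‖ ≤ ‖x‖ := norm_le_norm_of_abs_le_abs (by
    rw [abs_of_nonneg hy.1, abs_of_nonneg hx]; exact hy.2)
  exact (le_abs_self _).trans ((f.le_opNorm y).trans (by gcongr))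

theorem bddAbove_image (f : StrongDual ℝ E) (x : E) : BddAbove (f '' Set.Icc 0 x) :=
  ⟨‖f‖ * ‖x‖, by rintro _ ⟨y, hy, rfl⟩; exact apply_le_of_mem_Icc f hy⟩

theorem le_posAux (f : StrongDual ℝ E) {x y : E} (h0 : 0 ≤ y) (hy : y ≤ x) :
    f y ≤ posAux f x :=
  le_csSup (bddAbove_image f x) ⟨y, ⟨h0, hy⟩, rfl⟩

theorem posAux_le (f : StrongDual ℝ E) {x : E} (hx : 0 ≤ x) {c : ℝ}
    (h : ∀ y, 0 ≤ y → y ≤ x → f y ≤ c) : posAux f x ≤ c :=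
  csSup_le ⟨f 0, 0, ⟨le_rfl, hx⟩, rfl⟩ (by rintro _ ⟨y, hy, rfl⟩; exact h y hy.1 hy.2)

theorem posAux_nonneg (f : StrongDual ℝ E) {x : E} (hx : 0 ≤ x) : 0 ≤ posAux f x := by
  simpa using le_posAux f le_rfl hx

theorem posAux_add (f : StrongDual ℝ E) {x y : E} (hx : 0 ≤ x) (hy : 0 ≤ y) :
    posAux f (x + y) = posAux f x + posAux f y := by
  apply le_antisymm
  · refine posAux_le f (add_nonneg hx hy) fun z hz hzxy => ?_
    have h1 : z - z ⊓ x ≤ y := by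
      rw [sub_le_iff_le_add, ← sub_le_iff_le_add', le_inf_iff]
      constructor
      · exact sub_le_self _ hy
      · rwa [sub_le_iff_le_add]
    have h2 := le_posAux f (le_inf hz hx) (inf_le_right : z ⊓ x ≤ x)
    have h3 := le_posAux f (sub_nonneg.2 (inf_le_left : z ⊓ x ≤ z)) h1
    rw [map_sub] at h3
    linarith
  · rw [← le_sub_iff_add_le]
    refine posAux_le f hx fun a ha hax => ?_
    rw [le_sub_comm]
    refine posAux_le f hy fun b hb hby => ?_
    have := le_posAux f (add_nonneg ha hb) (add_le_add hax hby)
    rw [map_add] at this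
    linarith

theorem posAux_sub_eq (f : StrongDual ℝ E) {a b c d : E} (ha : 0 ≤ a) (hb : 0 ≤ b)
    (hc : 0 ≤ c) (hd : 0 ≤ d) (h : a - b = c - d) :
    posAux f a - posAux f b = posAux f c - posAux f d := by
  have h' : a + d = c + b := by rwa [sub_eq_sub_iff_add_eq_add] at h
  have := posAux_add f ha hd
  rw [h', posAux_add f hc hb] at this
  linarith

/-- The positive part of `f` as an additive map. -/
noncomputable def posHom (f : StrongDual ℝ E) : E →+ ℝ where
  toFun x := posAux f x⁺ - posAux f x⁻
  map_zero' := by simp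
  map_add' x y := by
    have h := posAux_sub_eq f (posPart_nonneg (x + y)) (negPart_nonneg (x + y))
      (add_nonneg (posPart_nonneg x) (posPart_nonneg y))
      (add_nonneg (negPart_nonneg x) (negPart_nonneg y))
      (by rw [posPart_sub_negPart, add_sub_add_comm, posPart_sub_negPart, posPart_sub_negPart])
    rw [h, posAux_add f (posPart_nonneg x) (posPart_nonneg y),
      posAux_add f (negPart_nonneg x) (negPart_nonneg y)]
    ring

theorem norm_posHom_le (f : StrongDual ℝ E) (x : E) : ‖posHom f x‖ ≤ ‖f‖ * ‖x‖ := by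
  have key : ∀ y : E, 0 ≤ y → y ≤ |x| → posAux f y ≤ ‖f‖ * ‖x‖ := fun y hy hyx =>
    posAux_le f hy fun z hz hzy => by
      simpa only [norm_abs_eq_norm] using apply_le_of_mem_Icc f ⟨hz, hzy.trans hyx⟩
  have h1 := key x⁺ (posPart_nonneg x) (sup_le (le_abs_self x) (abs_nonneg x))
  have h2 := key x⁻ (negPart_nonneg x) (sup_le (neg_le_abs x) (abs_nonneg x))
  have h3 := posAux_nonneg f (posPart_nonneg x)
  have h4 := posAux_nonneg f (negPart_nonneg x)
  change |posAux f x⁺ - posAux f x⁻| ≤ _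
  rw [abs_le]
  constructor <;> linarith

/-- The positive part `f ⊔ 0` of a functional `f`. -/
noncomputable def dualPos (f : StrongDual ℝ E) : StrongDual ℝ E :=
  (posHom f).toRealLinearMap
    (AddMonoidHomClass.continuous_of_bound (posHom f) ‖f‖ (norm_posHom_le f))

theorem dualPos_apply (f : StrongDual ℝ E) {x : E} (hx : 0 ≤ x) :
    dualPos f x = sSup (f '' Set.Icc 0 x) := by
  change posAux f x⁺ - posAux f x⁻ = posAux f x
  rw [posPart_of_nonneg hx, negPart_of_nonneg hx]
  simp [posAux]

/-- Any two elements of the dual have a supremum and an infimum. -/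
noncomputable instance dualLattice : Lattice (StrongDual ℝ E) where
  __ := dualPartialOrder
  sup f g := dualPos (f - g) + g
  inf f g := f - dualPos (f - g)
  le_sup_left f g x hx := by
    have h := le_posAux (f - g) hx le_rfl
    rw [add_apply, dualPos_apply _ hx]
    change _ ≤ posAux (f - g) x + _
    rw [sub_apply] at h
    linarith
  le_sup_right f g x hx := by
    have h := posAux_nonneg (f - g) hx
    rw [add_apply, dualPos_apply _ hx]
    change _ ≤ posAux (f - g) x + _
    linarith
  sup_le f g k hf hg x hx := by
    rw [add_apply, dualPos_apply _ hx]
    change posAux (f - g) x + _ ≤ _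
    rw [← le_sub_iff_add_le]
    refine posAux_le _ hx fun y hy hyx => ?_
    have h1 := hf y hy
    have h2 := hg (x - y) (sub_nonneg.2 hyx)
    rw [map_sub, map_sub] at h2
    rw [sub_apply]
    linarith
  inf_le_left f g x hx := by
    have h := posAux_nonneg (f - g) hx
    rw [sub_apply, dualPos_apply _ hx]
    change _ - posAux (f - g) x ≤ _
    linarith
  inf_le_right f g x hx := by
    have h := le_posAux (f - g) hx le_rfl
    rw [sub_apply, dualPos_apply _ hx]
    change _ - posAux (f - g) x ≤ _
    rw [sub_apply] at h
    linarith
  le_inf k f g hf hg x hx := by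
    rw [sub_apply, dualPos_apply _ hx]
    change _ ≤ _ - posAux (f - g) x
    rw [le_sub_comm]
    refine posAux_le _ hx fun y hy hyx => ?_
    have h1 := hg y hy
    have h2 := hf (x - y) (sub_nonneg.2 hyx)
    rw [map_sub, map_sub] at h2
    rw [sub_apply]
    linarith

instance dualIsOrderedAddMonoid : IsOrderedAddMonoid (StrongDual ℝ E) where
  add_le_add_left f g hfg k x hx := by
    simpa using hfg x hx

end Dual

/-- The norm of `E` is order continuous: `‖x_α‖ → 0` for every net `x_α ↓ 0` in `E`. -/
def OrderContinuousNorm (E : Type u) [NormedAddCommGroup E] [Lattice E] : Prop :=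
  ∀ (ι : Type u) [Preorder ι] [IsDirectedOrder ι] [Nonempty ι] (x : ι → E),
    Antitone x → IsGLB (Set.range x) 0 → Tendsto (fun i => ‖x i‖) atTop (𝓝 0)

/-- The sequence `x` converges to `a` in the weak topology of `E`. -/
def WeakLim {E : Type u} [NormedAddCommGroup E] [NormedSpace ℝ E] (x : ℕ → E) (a : E) : Prop :=
  Tendsto (fun n => toWeakSpace ℝ E (x n)) atTop (𝓝 (toWeakSpace ℝ E a))

/-- The lattice operations `(x, y) ↦ x ⊔ y` and `(x, y) ↦ x ⊓ y` of `E` are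
sequentially continuous for the weak topology. -/
def WeaklySeqContinuousLatticeOps (E : Type u) [NormedAddCommGroup E] [NormedSpace ℝ E]
    [Lattice E] : Prop :=
  ∀ (x y : ℕ → E) (a b : E), WeakLim x a → WeakLim y b →
    WeakLim (fun n => x n ⊔ y n) (a ⊔ b) ∧ WeakLim (fun n => x n ⊓ y n) (a ⊓ b)

section Limited

variable {E : Type u} [NormedAddCommGroup E] [NormedSpace ℝ E] [Lattice E]
  [IsOrderedAddMonoid E] [HasSolidNorm E]

/-- A bounded set `A` is almost limited if every disjoint weak* null sequence in the dual
converges to zero uniformly on `A`. -/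
def IsAlmostLimited (A : Set E) : Prop :=
  Bornology.IsBounded A ∧
    ∀ f : ℕ → StrongDual ℝ E, (∀ m n, m ≠ n → |f m| ⊓ |f n| = 0) →
      Tendsto (fun n => StrongDual.toWeakDual (f n)) atTop (𝓝 0) →
      TendstoUniformlyOn (fun n (x : E) => f n x) (fun _ => 0) atTop A

/-- A set `A` in the dual of `E` is strong L-limited if every almost limited weakly null
sequence in `E` converges to zero uniformly on `A`. -/
def IsStrongLLimited (A : Set (StrongDual ℝ E)) : Prop :=
  ∀ x : ℕ → E, IsAlmostLimited (Set.range x) → WeakLim x 0 →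
    TendstoUniformlyOn (fun n (f : StrongDual ℝ E) => f (x n)) (fun _ => 0) atTop A

end Limited

end BanachLattice

/-! Let `x n` be almost limited and weakly null. If some `f` in `A` has `|f| |x n| ≥ ε`, then `|f y|
≥ ε / 2` for some `|y| ≤ |x n|`. One such `y n` per index gives a weakly null sequence
(`WeakLim.of_abs_le`) that is almost limited (`IsAlmostLimited.of_subset_solidClosure`), so this
fails for large `n`. Thus `|f| |x n|`, which dominates `|g (x n)|` for `|g| ≤ |f|`, tends to zero
uniformly on `A`.

The substance is that solid hulls preserve almost limitedness. By Hahn-Banach, `|f n| |x|` is the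
value at `x` of some `h n` with `|h n| ≤ |f n|`. The `h n` inherit disjointness, and are weak* null
because the `|f n|` are; the latter is `tendsto_abs_apply`, where order continuity enters. -/

namespace BanachLattice

/-! ### Weak and weak* convergence, tested pointwise. -/

section WeakConvergence

variable {E : Type u} [NormedAddCommGroup E] [NormedSpace ℝ E]

theorem weakLim_iff {x : ℕ → E} {a : E} :
    WeakLim x a ↔ ∀ φ : StrongDual ℝ E, Tendsto (fun n => φ (x n)) atTop (𝓝 (φ a)) := by
  refine ⟨fun h φ => ?_, fun h => ?_⟩
  · exact ((WeakBilin.eval_continuous (topDualPairing ℝ E).flip φ).tendsto _).comp h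
  · refine (WeakBilin.tendsto_iff_forall_eval_tendsto (topDualPairing ℝ E).flip ?_).2 h
    refine fun y z hyz => by_contra fun hne => ?_
    obtain ⟨φ, hφ⟩ := SeparatingDual.exists_separating_of_ne (R := ℝ) hne
    exact hφ (LinearMap.congr_fun hyz φ)

theorem tendsto_toWeakDual_zero_iff {f : ℕ → StrongDual ℝ E} :
    Tendsto (fun n => StrongDual.toWeakDual (f n)) atTop (𝓝 0) ↔
      ∀ x, Tendsto (fun n => f n x) atTop (𝓝 0) :=
  tendsto_iff_forall_eval_tendsto_topDualPairing

end WeakConvergence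

theorem abs_smul_of_pos {E : Type*} [AddCommGroup E] [Lattice E] [Module ℝ E]
    [IsOrderedModule ℝ E] {c : ℝ} (hc : 0 < c) (x : E) : |c • x| = c • |x| := by
  have key : ∀ (d : ℝ) (y : E), 0 ≤ d → |d • y| ≤ d • |y| := fun d y hd =>
    abs_le'.2 ⟨smul_le_smul_of_nonneg_left (le_abs_self y) hd, by
      rw [← smul_neg]; exact smul_le_smul_of_nonneg_left (neg_le_abs y) hd⟩
  refine le_antisymm (key c x hc.le) ?_
  have h := smul_le_smul_of_nonneg_left (key c⁻¹ (c • x) (inv_nonneg.2 hc.le)) hc.le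
  rwa [inv_smul_smul₀ hc.ne', smul_inv_smul₀ hc.ne'] at h

/-! ### Moduli of functionals. -/

section Functionals

variable {E : Type u} [NormedAddCommGroup E] [NormedSpace ℝ E] [Lattice E]
  [IsOrderedAddMonoid E] [HasSolidNorm E]

theorem apply_mono_of_nonneg {μ : StrongDual ℝ E} (hμ : 0 ≤ μ) {x y : E} (h : x ≤ y) :
    μ x ≤ μ y := by
  have := dual_le_def.1 hμ (y - x) (sub_nonneg.2 h)
  rw [map_sub] at this
  simpa using this

theorem apply_nonneg_of_nonneg {μ : StrongDual ℝ E} (hμ : 0 ≤ μ) {x : E} (h : 0 ≤ x) :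
    0 ≤ μ x := by
  simpa using apply_mono_of_nonneg hμ h

theorem dual_abs_nonneg (f : StrongDual ℝ E) : 0 ≤ |f| := abs_nonneg f

theorem abs_apply_le (f : StrongDual ℝ E) (x : E) : |f x| ≤ |f| |x| := by
  have key : ∀ y : E, 0 ≤ y → |f y| ≤ |f| y := fun y hy => by
    have h1 := dual_le_def.1 (le_abs_self f) y hy
    have h2 := dual_le_def.1 (neg_le_abs f) y hy
    rw [neg_apply] at h2
    exact abs_le'.2 ⟨h1, h2⟩
  calc |f x| = |f x⁺ - f x⁻| := by rw [← map_sub, posPart_sub_negPart]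
    _ ≤ |f x⁺| + |f x⁻| := abs_sub _ _
    _ ≤ |f| x⁺ + |f| x⁻ := add_le_add (key _ (posPart_nonneg x)) (key _ (negPart_nonneg x))
    _ = |f| |x| := by rw [← map_add, posPart_add_negPart]

theorem dual_abs_le {f μ : StrongDual ℝ E} (h : ∀ x : E, 0 ≤ x → |f x| ≤ μ x) : |f| ≤ μ :=
  abs_le'.2 ⟨fun x hx => (le_abs_self _).trans (h x hx), fun x hx => by
    rw [neg_apply]; exact (neg_le_abs _).trans (h x hx)⟩

theorem exists_dualPos_sub_lt (f : StrongDual ℝ E) {x : E} (hx : 0 ≤ x) {ε : ℝ} (hε : 0 < ε) :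
    ∃ y, 0 ≤ y ∧ y ≤ x ∧ dualPos f x - ε < f y := by
  have hne : (f '' Set.Icc 0 x).Nonempty := ⟨f 0, 0, ⟨le_rfl, hx⟩, rfl⟩
  rw [dualPos_apply f hx]
  obtain ⟨_, ⟨y, hy, rfl⟩, h⟩ := exists_lt_of_lt_csSup hne (sub_lt_self _ hε)
  exact ⟨y, hy.1, hy.2, h⟩

theorem exists_abs_apply_lt (f : StrongDual ℝ E) {x : E} (hx : 0 ≤ x) {ε : ℝ} (hε : 0 < ε) :
    ∃ y, 0 ≤ y ∧ y ≤ x ∧ |f| x < 2 * f y - f x + ε := by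
  obtain ⟨y, h0, h1, h2⟩ := exists_dualPos_sub_lt (f - -f) hx hε
  refine ⟨y, h0, h1, ?_⟩
  -- By construction of the dual lattice, `f ⊔ -f` is `dualPos (f - -f) + -f`.
  have h3 : |f| x = dualPos (f - -f) x + -f x := rfl
  rw [sub_apply, neg_apply] at h2
  linarith

/-- Disjoint functionals are concentrated on complementary parts of any positive element. -/
theorem exists_apply_lt_of_inf_eq_zero {f g : StrongDual ℝ E} (h : f ⊓ g = 0) {x : E}
    (hx : 0 ≤ x) {ε : ℝ} (hε : 0 < ε) :
    ∃ v, 0 ≤ v ∧ v ≤ x ∧ f v < ε ∧ g (x - v) < ε := by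
  have hf : 0 ≤ f := h ▸ inf_le_left
  have hg : 0 ≤ g := h ▸ inf_le_right
  obtain ⟨y, h0, h1, h2⟩ := exists_dualPos_sub_lt (f - g) hx hε
  have h3 : f x - dualPos (f - g) x = 0 := congrArg (fun k : StrongDual ℝ E => k x) h
  have h4 := apply_nonneg_of_nonneg hg h0
  have h5 := apply_nonneg_of_nonneg hf (sub_nonneg.2 h1)
  rw [sub_apply] at h2
  refine ⟨x - y, sub_nonneg.2 h1, sub_le_self _ h0, ?_, ?_⟩
  · rw [map_sub]; linarith
  · rw [map_sub] at h5
    rw [sub_sub_cancel]; linarith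

/-- The value `|f| |x|` is attained by a functional dominated by `f`. -/
theorem exists_abs_le_apply_eq [IsOrderedModule ℝ E] (f : StrongDual ℝ E) (x : E) :
    ∃ h : StrongDual ℝ E, |h| ≤ |f| ∧ h x = |f| |x| := by
  rcases eq_or_ne x 0 with rfl | hx
  · exact ⟨f, le_rfl, by simp⟩
  have hpos : ∀ y : E, 0 ≤ |f| |y| := fun y =>
    apply_nonneg_of_nonneg (dual_abs_nonneg f) (abs_nonneg y)
  have hom : ∀ c : ℝ, 0 < c → ∀ y : E, |f| |c • y| = c * |f| |y| := fun c hc y => by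
    rw [abs_smul_of_pos hc, map_smul, smul_eq_mul]
  -- Hahn-Banach with the sublinear bound `y ↦ |f| |y|`, which on the line through `x` dominates `c
  -- • x ↦ c * |f| |x|`.
  obtain ⟨g, hg, hle⟩ := exists_extension_of_le_sublinear
    (LinearPMap.mkSpanSingleton x (|f| |x|) hx) (fun y => |f| |y|) hom
    (fun y z => by
      rw [← map_add]
      exact apply_mono_of_nonneg (dual_abs_nonneg f) (abs_add_le y z))
    (by
      rintro ⟨y, hy⟩
      obtain ⟨c, rfl⟩ := Submodule.mem_span_singleton.1 hy
      refine (LinearPMap.mkSpanSingleton'_apply x (|f| |x|) _ c hy).trans_le ?_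
      rw [RingHom.id_apply, smul_eq_mul]
      rcases le_or_gt c 0 with hc | hc
      · exact (mul_nonpos_of_nonpos_of_nonneg hc (hpos x)).trans (hpos _)
      · exact (hom c hc x).ge)
  have habs : ∀ y, |g y| ≤ |f| |y| := fun y => abs_le'.2 ⟨hle y, by
    rw [← map_neg, ← abs_neg y]; exact hle (-y)⟩
  refine ⟨g.mkContinuous ‖(|f| : StrongDual ℝ E)‖ fun y => ?_, dual_abs_le fun y hy => ?_, ?_⟩
  · rw [Real.norm_eq_abs]
    refine (habs y).trans ((le_abs_self _).trans ?_)
    have := (|f| : StrongDual ℝ E).le_opNorm |y|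
    rwa [norm_abs_eq_norm y] at this
  · have h := habs y
    rwa [abs_of_nonneg hy] at h
  · have h := hg ⟨x, Submodule.mem_span_singleton_self x⟩
    rw [LinearPMap.mkSpanSingleton_apply] at h
    exact h

theorem WeakLim.of_abs_le (hops : WeaklySeqContinuousLatticeOps E) {x y : ℕ → E}
    (hx : WeakLim x 0) (h : ∀ n, |y n| ≤ |x n|) : WeakLim y 0 := by
  have hneg : WeakLim (fun n => -x n) 0 := weakLim_iff.2 fun φ => by
    simpa using (weakLim_iff.1 hx φ).neg
  have habs := weakLim_iff.1 (hops _ _ _ _ hx hneg).1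
  refine weakLim_iff.2 fun φ => ?_
  rw [map_zero]
  refine squeeze_zero_norm (fun n => ?_) (by simpa using habs |φ|)
  exact (abs_apply_le φ (y n)).trans (apply_mono_of_nonneg (dual_abs_nonneg φ) (h n))

end Functionals

/-! ### Order bounded sequences under an order continuous norm. -/

section OrderContinuous

variable {E : Type u} [NormedAddCommGroup E] [NormedSpace ℝ E] [Lattice E]
  [IsOrderedAddMonoid E] [HasSolidNorm E]

/-- A positive element all of whose multiples are bounded above by a fixed element is zero. -/
theorem eq_zero_of_forall_nsmul_le {e x : E} (he : 0 ≤ e) (h : ∀ n : ℕ, n • e ≤ x) : e = 0 := by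
  have hbound : ∀ n : ℕ, n * ‖e‖ ≤ ‖x‖ := fun n => by
    have h0 : 0 ≤ n • e := nsmul_nonneg he n
    have := norm_le_norm_of_abs_le_abs (a := n • e) (b := x) (by
      rw [abs_of_nonneg h0, abs_of_nonneg (h0.trans (h n))]; exact h n)
    rwa [← Nat.cast_smul_eq_nsmul ℝ, norm_smul, Real.norm_natCast] at this
  by_contra hne
  obtain ⟨n, hn⟩ := exists_nat_gt (‖x‖ / ‖e‖)
  rw [div_lt_iff₀ (norm_pos_iff.2 hne)] at hn
  exact absurd (hbound n) hn.not_ge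

/-- In a lattice with order continuous norm, increasing order bounded sequences are Cauchy. -/
theorem OrderContinuousNorm.cauchySeq_of_monotone (hE : OrderContinuousNorm E) {z : ℕ → E}
    (hz : Monotone z) {x : E} (hx : ∀ n, z n ≤ x) : CauchySeq z := by
  -- The gaps between upper bounds of `z` and terms of `z` are directed downwards with infimum zero,
  -- even if `z` is not known to have a supremum.
  let S : Set E := {d | ∃ b k, (∀ n, z n ≤ b) ∧ d = b - z k}
  have : Nonempty (↥S)ᵒᵈ := ⟨OrderDual.toDual ⟨x - z 0, x, 0, hx, rfl⟩⟩
  have : IsDirectedOrder (↥S)ᵒᵈ := ⟨by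
    rintro ⟨_, b, k, hb, rfl⟩ ⟨_, c, l, hc, rfl⟩
    refine ⟨OrderDual.toDual ⟨b ⊓ c - z (max k l), b ⊓ c, max k l,
      fun n => le_inf (hb n) (hc n), rfl⟩, ?_, ?_⟩
    · exact sub_le_sub (inf_le_left : b ⊓ c ≤ b) (hz (le_max_left k l))
    · exact sub_le_sub (inf_le_right : b ⊓ c ≤ c) (hz (le_max_right k l))⟩
  have hglb : IsGLB (Set.range fun i : (↥S)ᵒᵈ => ((OrderDual.ofDual i : S) : E)) 0 := by
    constructor
    · rintro _ ⟨⟨_, b, k, hb, rfl⟩, rfl⟩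
      exact sub_nonneg.2 (hb k)
    · intro e he
      have he' : ∀ b k, (∀ n, z n ≤ b) → e ≤ b - z k := fun b k hb =>
        he ⟨OrderDual.toDual ⟨b - z k, b, k, hb, rfl⟩, rfl⟩
      have hpos : ∀ b k, (∀ n, z n ≤ b) → e⁺ ≤ b - z k := fun b k hb =>
        sup_le (he' b k hb) (sub_nonneg.2 (hb k))
      -- If `b` bounds `z`, so does `b - e⁺`; this iterates from `x`, and the Archimedean property
      -- then forces `e⁺ = 0`.
      have hstep : ∀ j : ℕ, ∀ n, z n ≤ x - j • e⁺ := fun j => by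
        induction j with
        | zero => simpa using hx
        | succ j ih =>
          intro n
          have := hpos _ n ih
          rw [succ_nsmul, ← sub_sub]
          exact le_sub_comm.1 this
      have h0 : e⁺ = 0 := eq_zero_of_forall_nsmul_le (x := x - z 0) (posPart_nonneg e)
        fun j => le_sub_comm.1 (hstep j 0)
      exact posPart_eq_zero.1 h0
  have hlim := hE (↥S)ᵒᵈ (fun i => ((OrderDual.ofDual i : S) : E)) (fun _ _ h => h) hglb
  rw [Metric.cauchySeq_iff']
  intro ε hε
  obtain ⟨⟨_, b, k, hb, rfl⟩, hi⟩ := (hlim.eventually (gt_mem_nhds hε)).exists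
  refine ⟨k, fun n hn => ?_⟩
  rw [dist_eq_norm]
  refine lt_of_le_of_lt (norm_le_norm_of_abs_le_abs ?_) hi
  have h1 : z n - z k ≤ b - z k := sub_le_sub_right (hb n) _
  have h0 : 0 ≤ z n - z k := sub_nonneg.2 (hz hn)
  change |z n - z k| ≤ |b - z k|
  rwa [abs_of_nonneg h0, abs_of_nonneg (h0.trans h1)]

/-- In a Banach lattice with order continuous norm, an order bounded sequence has a supremum,
and its partial suprema converge to it in norm. -/
theorem OrderContinuousNorm.exists_tendsto_partialSups [CompleteSpace E]
    (hE : OrderContinuousNorm E) {w : ℕ → E} {x : E} (hx : ∀ n, w n ≤ x) :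
    ∃ z, (∀ n, w n ≤ z) ∧ z ≤ x ∧ Tendsto (fun n => partialSups w n) atTop (𝓝 z) := by
  have hb : ∀ n, partialSups w n ≤ x := fun n => partialSups_le w n x fun j _ => hx j
  obtain ⟨z, hz⟩ := cauchySeq_tendsto_of_complete
    (hE.cauchySeq_of_monotone (partialSups_monotone w) hb)
  exact ⟨z, fun n => (le_partialSups w n).trans ((partialSups_monotone w).ge_of_tendsto hz n),
    le_of_tendsto' hz hb, hz⟩

/-- A finite supremum of positive elements is at most their sum, so a summable bound on the values
of `μ` survives the passage to a countable supremum. -/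
theorem apply_le_add_of_tendsto_partialSups {w w' : ℕ → E} {a z : E} {μ : StrongDual ℝ E}
    (hμ : 0 ≤ μ) (hz : Tendsto (fun n => partialSups w n) atTop (𝓝 z)) (hw' : ∀ n, 0 ≤ w' n)
    (hle : ∀ n, w n ≤ a + w' n) {c : ℕ → ℝ} {C : ℝ} (hc : HasSum c C)
    (hcw : ∀ n, μ (w' n) ≤ c n) : μ z ≤ μ a + C := by
  refine le_of_tendsto' ((μ.continuous.tendsto z).comp hz) fun n => ?_
  have h1 : partialSups w n ≤ a + ∑ m ∈ Finset.range (n + 1), w' m :=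
    partialSups_le _ _ _ fun j hj => (hle j).trans (by
      gcongr
      exact Finset.single_le_sum (fun i _ => hw' i) (Finset.mem_range.2 (Nat.lt_succ_of_le hj)))
  have h2 := apply_mono_of_nonneg hμ h1
  rw [map_add, map_sum] at h2
  refine h2.trans (by
    gcongr
    refine (Finset.sum_le_sum fun i _ => hcw i).trans (sum_le_hasSum _ (fun i _ => ?_) hc)
    exact (apply_nonneg_of_nonneg hμ (hw' i)).trans (hcw i))

/-! ### Disjoint weak* null sequences and solid hulls. -/

/-- In a Banach lattice with order continuous norm, the absolute values of a disjoint weak* null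
sequence of functionals form a weak* null sequence. -/
theorem OrderContinuousNorm.tendsto_abs_apply [CompleteSpace E] (hE : OrderContinuousNorm E)
    {f : ℕ → StrongDual ℝ E} (hdisj : ∀ m n, m ≠ n → |f m| ⊓ |f n| = 0)
    (hf : ∀ x, Tendsto (fun n => f n x) atTop (𝓝 0)) {x : E} (hx : 0 ≤ x) :
    Tendsto (fun n => |f n| x) atTop (𝓝 0) := by
  let δ : ℕ → ℕ → ℝ := fun n m => (1 / 2) ^ n * (1 / 2) ^ m
  have hδ : ∀ n m, 0 < δ n m := fun n m => by positivity
  have hsum : ∀ n, HasSum (δ n) ((1 / 2) ^ n * 2) := fun n => hasSum_geometric_two.mul_left _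
  have hex : ∀ n m, ∃ v, 0 ≤ v ∧ v ≤ x ∧ |f n| v ≤ δ n m ∧
      (m ≠ n → |f m| (x - v) ≤ δ n m) := fun n m => by
    rcases eq_or_ne m n with rfl | h
    · exact ⟨0, le_rfl, hx, by simpa using (hδ m m).le, fun h => absurd rfl h⟩
    · obtain ⟨v, h0, h1, h2, h3⟩ := exists_apply_lt_of_inf_eq_zero (hdisj n m h.symm) hx (hδ n m)
      exact ⟨v, h0, h1, h2.le, fun _ => h3.le⟩
  -- The supremum `a n` of the `v n m` over `m` is nearly null for `|f n|`, while `x - a n` is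
  -- nearly null for every other `|f m|`.
  choose v hv0 hvx hvn hvm using hex
  choose a hva hax ha using fun n => hE.exists_tendsto_partialSups (hvx n)
  choose y hy0 hyx hy using fun n =>
    exists_abs_apply_lt (f n) hx (pow_pos (one_half_pos (α := ℝ)) n)
  have han : ∀ n, |f n| (a n) ≤ (1 / 2) ^ n * 2 := fun n => by
    simpa using apply_le_add_of_tendsto_partialSups (a := 0) (dual_abs_nonneg (f n)) (ha n)
      (hv0 n) (fun m => by simp) (hsum n) (hvn n)
  -- This is `(y n - a n)⁺`: it lies below `x - a n`, and `f n` barely distinguishes it from `y n`.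
  let w : ℕ → E := fun n => y n - y n ⊓ a n
  have hw0 : ∀ n, 0 ≤ w n := fun n => sub_nonneg.2 inf_le_left
  have hwx : ∀ n, w n ≤ x - a n := fun n => by
    have h1 : y n ⊔ a n ≤ x := sup_le (hyx n) (hax n)
    have h2 : y n - y n ⊓ a n = y n ⊔ a n - a n := by
      rw [sub_eq_sub_iff_add_eq_add, add_comm (y n ⊔ a n), inf_add_sup]
    simp only [w, h2]
    exact sub_le_sub_right h1 _
  have ha0 : ∀ n, 0 ≤ a n := fun n => (hv0 n 0).trans (hva n 0)
  -- One element `z` serves all `n`: the terms `w m` with `m ≠ n` are almost invisible to `|f n|`,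
  -- so `f n z` is close to `f n (w n)`.
  obtain ⟨z, hwz, -, hz⟩ := hE.exists_tendsto_partialSups
    (fun n => (hwx n).trans (sub_le_self x (ha0 n)))
  have hzn : ∀ n, |f n| z ≤ |f n| (w n) + (1 / 2) ^ n * 2 := fun n => by
    refine apply_le_add_of_tendsto_partialSups (w' := fun m => if m = n then 0 else w m)
      (dual_abs_nonneg (f n)) hz (fun m => ?_) (fun m => ?_) (hsum n) (fun m => ?_)
    · split_ifs
      exacts [le_rfl, hw0 m]
    · split_ifs with h
      · rw [h, add_zero]
      · exact le_add_of_nonneg_left (hw0 n)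
    · split_ifs with h
      · simpa using (hδ n m).le
      · have h1 : w m ≤ x - v m n := (hwx m).trans (sub_le_sub_left (hva m n) x)
        refine (apply_mono_of_nonneg (dual_abs_nonneg (f n)) h1).trans ?_
        refine (hvm m n (Ne.symm h)).trans_eq ?_
        exact mul_comm _ _
  -- Replacing `y n` by `w n` and `w n` by `z` costs `2 * (1 / 2) ^ n` each; doubling, plus the
  -- error in choosing `y n`, gives 9.
  have hbound : ∀ n, |f n| x ≤ 2 * |f n z| + |f n x| + 9 * (1 / 2) ^ n := fun n => by
    have h1 := abs_apply_le (f n) (z - w n)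
    rw [abs_of_nonneg (sub_nonneg.2 (hwz n)), map_sub (f n), map_sub |f n|] at h1
    have h2 := abs_apply_le (f n) (y n ⊓ a n)
    rw [abs_of_nonneg (le_inf (hy0 n) (ha0 n))] at h2
    have h3 := apply_mono_of_nonneg (dual_abs_nonneg (f n)) (inf_le_right : y n ⊓ a n ≤ a n)
    have h4 : f n (w n) = f n (y n) - f n (y n ⊓ a n) := map_sub _ _ _
    have h5 := hzn n
    have h6 := han n
    have h7 := hy n
    have h8 := (abs_le.1 h1).1
    have h9 := (abs_le.1 h2).2
    have h10 := le_abs_self (f n z)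
    have h11 := neg_abs_le (f n x)
    linarith
  refine squeeze_zero (fun n => apply_nonneg_of_nonneg (dual_abs_nonneg (f n)) hx) hbound ?_
  have hgeo := (tendsto_pow_atTop_nhds_zero_of_lt_one (r := (1 / 2 : ℝ)) (by norm_num)
    (by norm_num)).const_mul 9
  simpa using (((hf z).abs.const_mul 2).add (hf x).abs).add hgeo

/-- In a Banach lattice with order continuous norm, the solid hull of an almost limited set is
almost limited. -/
theorem IsAlmostLimited.of_subset_solidClosure [CompleteSpace E] [IsOrderedModule ℝ E]
    (hE : OrderContinuousNorm E) {S T : Set E} (hS : IsAlmostLimited S)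
    (hT : ∀ y ∈ T, ∃ x ∈ S, |y| ≤ |x|) : IsAlmostLimited T := by
  refine ⟨?_, fun f hdisj hf => ?_⟩
  · obtain ⟨C, hC⟩ := isBounded_iff_forall_norm_le.1 hS.1
    refine isBounded_iff_forall_norm_le.2 ⟨C, fun y hy => ?_⟩
    obtain ⟨x, hx, hyx⟩ := hT y hy
    exact (norm_le_norm_of_abs_le_abs hyx).trans (hC x hx)
  rw [Metric.tendstoUniformlyOn_iff]
  intro ε hε
  have hex : ∀ n, ∃ h : StrongDual ℝ E, |h| ≤ |f n| ∧
      ((∃ x ∈ S, ε ≤ |f n| |x|) → ∃ x ∈ S, ε ≤ h x) := fun n => by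
    by_cases H : ∃ x ∈ S, ε ≤ |f n| |x|
    · obtain ⟨x, hx, hεx⟩ := H
      obtain ⟨h, h1, h2⟩ := exists_abs_le_apply_eq (f n) x
      exact ⟨h, h1, fun _ => ⟨x, hx, hεx.trans_eq h2.symm⟩⟩
    -- The default `f n` keeps the whole sequence dominated by `f`.
    · exact ⟨f n, le_rfl, fun h => absurd h H⟩
  choose h hle hh using hex
  have hdisj' : ∀ m n, m ≠ n → |h m| ⊓ |h n| = 0 := fun m n hmn =>
    le_antisymm ((inf_le_inf (hle m) (hle n)).trans_eq (hdisj m n hmn))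
      (le_inf (dual_abs_nonneg _) (dual_abs_nonneg _))
  have hnull : ∀ x, Tendsto (fun n => h n x) atTop (𝓝 0) := fun x =>
    squeeze_zero_norm
      (fun n => (abs_apply_le (h n) x).trans (dual_le_def.1 (hle n) |x| (abs_nonneg x)))
      (hE.tendsto_abs_apply hdisj (tendsto_toWeakDual_zero_iff.1 hf) (abs_nonneg x))
  have hunif := Metric.tendstoUniformlyOn_iff.1
    (hS.2 h hdisj' (tendsto_toWeakDual_zero_iff.2 hnull)) ε hε
  filter_upwards [hunif] with n hn y hy
  obtain ⟨x, hx, hyx⟩ := hT y hy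
  rw [dist_zero_left, Real.norm_eq_abs]
  refine ((abs_apply_le (f n) y).trans
    (apply_mono_of_nonneg (dual_abs_nonneg _) hyx)).trans_lt (lt_of_not_ge fun hge => ?_)
  obtain ⟨x', hx', hεx'⟩ := hh n ⟨x, hx, hge⟩
  have := hn x' hx'
  rw [dist_zero_left, Real.norm_eq_abs] at this
  exact (hεx'.trans (le_abs_self _)).not_gt this

/-- A positive lower bound of `|f| x` is attained, up to a factor, by `|f y|` for some
`|y| ≤ x`. -/
theorem exists_le_abs_apply (f : StrongDual ℝ E) {x : E} (hx : 0 ≤ x) {ε : ℝ} (hε : 0 < ε)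
    (h : ε ≤ |f| x) : ∃ y : E, |y| ≤ x ∧ ε / 2 ≤ |f y| := by
  obtain ⟨y, h0, h1, h2⟩ := exists_abs_apply_lt f hx (half_pos hε)
  -- The witness is `2y - x`, since `|f| x` is the supremum of `f (2y - x)` over `0 ≤ y ≤ x`.
  refine ⟨y - (x - y), abs_le'.2 ⟨?_, ?_⟩, ?_⟩
  · exact (sub_le_self _ (sub_nonneg.2 h1)).trans h1
  · rw [neg_sub]
    exact (sub_le_self _ h0).trans (sub_le_self _ h0)
  · refine le_trans ?_ (le_abs_self _)
    rw [map_sub, map_sub]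
    linarith

end OrderContinuous

end BanachLattice

/-! ### The theorem. -/

theorem mainTheorem10 {E : Type u} [NormedAddCommGroup E] [NormedSpace ℝ E] [CompleteSpace E]
    [Lattice E] [IsOrderedAddMonoid E] [IsOrderedModule ℝ E] [HasSolidNorm E]
    (hE : BanachLattice.OrderContinuousNorm E)
    (hops : BanachLattice.WeaklySeqContinuousLatticeOps E)
    (A : Set (StrongDual ℝ E)) (hA : BanachLattice.IsStrongLLimited A) :
    BanachLattice.IsStrongLLimited (LatticeOrderedAddCommGroup.solidClosure A) := by
  intro x hlim hweak
  rw [Metric.tendstoUniformlyOn_iff]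
  intro ε hε
  have hex : ∀ n, ∃ y : E, |y| ≤ |x n| ∧
      ((∃ f ∈ A, ε ≤ |f| |x n|) → ∃ f ∈ A, ε / 2 ≤ |f y|) := fun n => by
    by_cases H : ∃ f ∈ A, ε ≤ |f| |x n|
    · obtain ⟨f, hf, hεf⟩ := H
      obtain ⟨y, h1, h2⟩ := BanachLattice.exists_le_abs_apply f (abs_nonneg (x n)) hε hεf
      exact ⟨y, h1, fun _ => ⟨f, hf, h2⟩⟩
    · exact ⟨x n, le_rfl, fun h => absurd h H⟩
  choose y hyx hy using hex
  have hylim : BanachLattice.IsAlmostLimited (Set.range y) := hlim.of_subset_solidClosure hE (by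
    rintro _ ⟨n, rfl⟩
    exact ⟨x n, ⟨n, rfl⟩, hyx n⟩)
  have hunif := Metric.tendstoUniformlyOn_iff.1
    (hA y hylim (hweak.of_abs_le hops hyx)) (ε / 2) (half_pos hε)
  filter_upwards [hunif] with n hn g hg
  obtain ⟨f, hf, hgf⟩ := hg
  rw [dist_zero_left, Real.norm_eq_abs]
  refine ((BanachLattice.abs_apply_le g (x n)).trans
    (BanachLattice.dual_le_def.1 hgf _ (abs_nonneg (x n)))).trans_lt
    (lt_of_not_ge fun hge => ?_)
  obtain ⟨f', hf', hεf'⟩ := hy n ⟨f, hf, hge⟩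
  have := hn f' hf'
  rw [dist_zero_left, Real.norm_eq_abs] at this
  exact hεf'.not_gt this
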